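/- Let $K$ be a field and let $\Gamma,\Gamma'$ be quivers such that between any two vertices of $\Gamma$, and between any two vertices of $\Gamma'$, there are only finitely many paths. The path coalgebra $K\Gamma$ is the $K$-vector space with basis all paths of $\Gamma$ (including the vertices, as paths of length $0$), with comultiplication $\Delta(p)=\sum_{qr=p}q\otimes r$ and counit $\varepsilon(v)=1$ for every vertex $v$, $\varepsilon(p)=0$ for every path $p$ of positive length. A coalgebra $C$ over $K$ is called coreflexive if the natural embedding $C\to (C^*)^0$, $c\mapsto (f\mapsto f(c))$, is an isomorphism, where $C^*$ is the dual algebra of $C$ (with the convolution product) and, for a $K$-algebra $A$, the finite dual $A^0$ is the space of all $f\in A^*$ whose kernel contains a two-sided ideal of $A$ of finite codimension. Let $C$ be a subcoalgebra of $K\Gamma$ and $D$ a subcoalgebra of $K\Gamma'$. If $C$ and $D$ are coreflexive, then $C\otimes D$ is coreflexive. -/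

import Mathlib

open scoped TensorProduct

noncomputable section

universe w u v

/-! ### Path coalgebras -/

namespace Quiver.Path

variable {V : Type u} [Quiver.{v} V]

/-- The list of all factorizations `p = q r` of a path `p` (first `q`, then `r`), each one stored
as the triple (end of `q`, `q`, `r`). -/
def splits {a : V} : {b : V} → Path a b → List (Σ c : V, Path a c × Path c b)
  | _, nil => [⟨a, nil, nil⟩]
  | b, cons p e => (splits p).map (fun s => ⟨s.1, s.2.1, s.2.2.cons e⟩) ++ [⟨b, p.cons e, nil⟩]

/-- The list `splits p` contains exactly the factorizations of `p`. -/
theorem mem_splits {a b : V} (p : Path a b) (s : Σ c : V, Path a c × Path c b) :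
    s ∈ splits p ↔ s.2.1.comp s.2.2 = p := by
  induction p with
  | nil =>
    obtain ⟨c, q, r⟩ := s
    constructor
    · intro h
      simp only [splits, List.mem_singleton] at h
      cases h
      rfl
    · intro h
      cases r with
      | nil =>
        simp only [comp_nil] at h
        subst h
        simp [splits]
      | cons r e => simp at h
  | cons p e ih =>
    obtain ⟨c, q, r⟩ := s
    simp only [splits, List.mem_append, List.mem_map, List.mem_singleton]
    constructor
    · rintro (⟨s, hs, h⟩ | h)
      · cases h
        simp [(ih s).1 hs]
      · cases h
        rfl
    · intro h
      cases r with
      | nil =>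
        right
        simp only [comp_nil] at h
        subst h
        rfl
      | cons r e' =>
        left
        simp only [comp_cons] at h
        injection h with h1 _ h2 h3
        subst h1
        cases h2
        cases h3
        exact ⟨⟨c, q, r⟩, (ih _).2 rfl, rfl⟩

/-- Each factorization of `p` is listed once in `splits p`. -/
theorem nodup_splits {a b : V} (p : Path a b) : (splits p).Nodup := by
  induction p with
  | nil => simp [splits]
  | cons p e ih =>
    rw [splits, List.nodup_append]
    refine ⟨ih.map ?_, List.nodup_singleton _, ?_⟩
    · rintro ⟨c, q, r⟩ ⟨c', q', r'⟩ h
      simp only [Sigma.mk.injEq] at h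
      obtain ⟨rfl, h⟩ := h
      simpa using h
    · intro s hs t ht hst
      simp only [List.mem_singleton] at ht
      obtain ⟨s', -, rfl⟩ := List.mem_map.1 hs
      subst ht
      have := congrArg (fun s => s.2.2.length) hst
      simp at this

theorem sum_splits_assoc {M : Type*} [AddCommMonoid M] {a b : V} (p : Path a b)
    (F : (c d : V) → Path a c → Path c d → Path d b → M) :
    ((splits p).map fun s => ((splits s.2.1).map fun t => F t.1 s.1 t.2.1 t.2.2 s.2.2).sum).sum =
      ((splits p).map fun s =>
        ((splits s.2.2).map fun t => F s.1 t.1 s.2.1 t.2.1 t.2.2).sum).sum := by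
  induction p with
  | nil => simp [splits]
  | cons p e ih =>
    have h := ih (fun c d q r t => F c d q r (t.cons e))
    simp only [splits, List.map_append, List.map_map, List.sum_append, Function.comp_def,
      List.map_cons, List.map_nil, List.sum_cons, List.sum_nil, add_zero, List.sum_map_add, h]
    rw [add_assoc]

theorem sum_splits_left {M : Type*} [AddCommMonoid M] {a b : V} (p : Path a b)
    (F : (c : V) → Path a c → Path c b → M) :
    ((splits p).map fun s => if s.2.1.length = 0 then F s.1 s.2.1 s.2.2 else 0).sum =
      F a nil p := by
  induction p with
  | nil => simp [splits]
  | cons p e ih =>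
    have h := ih (fun c q r => F c q (r.cons e))
    simp [splits, Function.comp_def, h]

theorem sum_splits_right {M : Type*} [AddCommMonoid M] {a b : V} (p : Path a b)
    (F : (c : V) → Path a c → Path c b → M) :
    ((splits p).map fun s => if s.2.2.length = 0 then F s.1 s.2.1 s.2.2 else 0).sum =
      F b p nil := by
  cases p with
  | nil => simp [splits]
  | cons p e => simp [splits, Function.comp_def]

end Quiver.Path

/-- The path coalgebra `KΓ` of a quiver `Γ`: the `K`-vector space whose basis is the set of all
paths of `Γ`, including the paths of length zero (the vertices). -/
def PathCoalgebra (K : Type w) [Field K] (V : Type u) [Quiver.{v} V] : Type (max w u v) :=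
  (Σ a b : V, Quiver.Path a b) →₀ K

namespace PathCoalgebra

variable (K : Type w) [Field K] {V : Type u} [Quiver.{v} V]

instance : AddCommGroup (PathCoalgebra K V) :=
  inferInstanceAs (AddCommGroup ((Σ a b : V, Quiver.Path a b) →₀ K))

instance : Module K (PathCoalgebra K V) :=
  inferInstanceAs (Module K ((Σ a b : V, Quiver.Path a b) →₀ K))

variable (V) in
/-- The basis of `KΓ` that consists of all paths. -/
def basis : Module.Basis (Σ a b : V, Quiver.Path a b) K (PathCoalgebra K V) :=
  Finsupp.basisSingleOne

/-- A path as an element of the path coalgebra. -/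
def ofPath {a b : V} (p : Quiver.Path a b) : PathCoalgebra K V :=
  basis K V ⟨a, b, p⟩

/-- `Δ(p) = ∑ q ⊗ r`, the sum over all factorizations `p = q r`; `ε(p) = 1` if `p` is a vertex and
`ε(p) = 0` if `p` has positive length. -/
instance : CoalgebraStruct K (PathCoalgebra K V) where
  comul := (basis K V).constr K fun p =>
    (p.2.2.splits.map fun s => ofPath K s.2.1 ⊗ₜ[K] ofPath K s.2.2).sum
  counit := (basis K V).constr K fun p => if p.2.2.length = 0 then 1 else 0

theorem comul_ofPath {a b : V} (p : Quiver.Path a b) :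
    Coalgebra.comul (R := K) (ofPath K p) =
      (p.splits.map fun s => ofPath K s.2.1 ⊗ₜ[K] ofPath K s.2.2).sum :=
  (basis K V).constr_basis K _ _

theorem counit_ofPath {a b : V} (p : Quiver.Path a b) :
    Coalgebra.counit (R := K) (ofPath K p) = if p.length = 0 then (1 : K) else 0 :=
  (basis K V).constr_basis K _ _

instance : Coalgebra K (PathCoalgebra K V) where
  coassoc := by
    refine (basis K V).ext fun ⟨a, b, p⟩ => ?_
    change TensorProduct.assoc K _ _ _ (LinearMap.rTensor _ Coalgebra.comul
      (Coalgebra.comul (R := K) (ofPath K p))) =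
      LinearMap.lTensor _ Coalgebra.comul (Coalgebra.comul (R := K) (ofPath K p))
    have hl : ∀ (l : List (PathCoalgebra K V ⊗[K] PathCoalgebra K V)) (y : PathCoalgebra K V),
        l.sum ⊗ₜ[K] y = (l.map fun x => x ⊗ₜ[K] y).sum := fun l y =>
      map_list_sum ((TensorProduct.mk K _ _).flip y) l
    have hr : ∀ (l : List (PathCoalgebra K V ⊗[K] PathCoalgebra K V)) (y : PathCoalgebra K V),
        y ⊗ₜ[K] l.sum = (l.map fun x => y ⊗ₜ[K] x).sum := fun l y =>
      map_list_sum (TensorProduct.mk K _ _ y) l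
    rw [comul_ofPath]
    simp only [map_list_sum, List.map_map, Function.comp_def, LinearMap.rTensor_tmul,
      LinearMap.lTensor_tmul, comul_ofPath, hl, hr, TensorProduct.assoc_tmul]
    exact Quiver.Path.sum_splits_assoc p
      (fun c d q r t => ofPath K q ⊗ₜ[K] (ofPath K r ⊗ₜ[K] ofPath K t))
  rTensor_counit_comp_comul := by
    refine (basis K V).ext fun ⟨a, b, p⟩ => ?_
    change LinearMap.rTensor _ _ (Coalgebra.comul (R := K) (ofPath K p)) = 1 ⊗ₜ[K] ofPath K p
    rw [comul_ofPath]
    simp only [map_list_sum, List.map_map, Function.comp_def, LinearMap.rTensor_tmul,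
      counit_ofPath, TensorProduct.ite_tmul]
    exact Quiver.Path.sum_splits_left p (fun c q r => (1 : K) ⊗ₜ[K] ofPath K r)
  lTensor_counit_comp_comul := by
    refine (basis K V).ext fun ⟨a, b, p⟩ => ?_
    change LinearMap.lTensor _ _ (Coalgebra.comul (R := K) (ofPath K p)) = ofPath K p ⊗ₜ[K] 1
    rw [comul_ofPath]
    simp only [map_list_sum, List.map_map, Function.comp_def, LinearMap.lTensor_tmul,
      counit_ofPath, TensorProduct.tmul_ite]
    exact Quiver.Path.sum_splits_right p (fun c q r => ofPath K q ⊗ₜ[K] (1 : K))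

end PathCoalgebra

/-! ### Subcoalgebras -/

/-- A subcoalgebra of a coalgebra `H` over a field: a subspace `C` with `Δ(C) ⊆ C ⊗ C`, where
`C ⊗ C` is viewed inside `H ⊗ H`. -/
structure Subcoalgebra (K : Type*) (H : Type*) [Field K] [AddCommGroup H] [Module K H]
    [Coalgebra K H] extends Submodule K H where
  comul_mem : ∀ c ∈ toSubmodule, Coalgebra.comul (R := K) c ∈
    LinearMap.range (TensorProduct.map toSubmodule.subtype toSubmodule.subtype)

namespace Subcoalgebra

variable {K H : Type*} [Field K] [AddCommGroup H] [Module K H] [Coalgebra K H]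

/-- The type of elements of a subcoalgebra. -/
instance : CoeSort (Subcoalgebra K H) (Type _) := ⟨fun C => C.toSubmodule⟩

variable (C : Subcoalgebra K H)

/-- The inclusion of a subcoalgebra. -/
def incl : C →ₗ[K] H := C.toSubmodule.subtype

theorem incl_injective : Function.Injective C.incl := C.toSubmodule.injective_subtype

theorem map_incl_injective : Function.Injective (TensorProduct.map C.incl C.incl) :=
  TensorProduct.map_injective_of_flat_flat _ _ C.incl_injective C.incl_injective

/-- The comultiplication (the unique map `C → C ⊗ C` compatible with that of `H`) and the counit
that a subcoalgebra inherits. -/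
instance : CoalgebraStruct K C where
  comul := (LinearEquiv.ofInjective _ C.map_incl_injective).symm.toLinearMap ∘ₗ
    (Coalgebra.comul ∘ₗ C.incl).codRestrict (LinearMap.range (TensorProduct.map C.incl C.incl))
      (fun c => C.comul_mem c.1 c.2)
  counit := Coalgebra.counit ∘ₗ C.incl

theorem map_incl_comul (c : C) :
    TensorProduct.map C.incl C.incl (Coalgebra.comul (R := K) c) =
      Coalgebra.comul (R := K) (C.incl c) :=
  congrArg Subtype.val ((LinearEquiv.ofInjective _ C.map_incl_injective).apply_symm_apply _)

theorem counit_eq (c : C) :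
    Coalgebra.counit (R := K) c = Coalgebra.counit (R := K) (C.incl c) := rfl

theorem map_incl_comp_comul : TensorProduct.map C.incl C.incl ∘ₗ Coalgebra.comul =
    Coalgebra.comul (R := K) ∘ₗ C.incl :=
  LinearMap.ext C.map_incl_comul

instance : Coalgebra K C where
  coassoc := by
    have hinj : Function.Injective
        (TensorProduct.map C.incl (TensorProduct.map C.incl C.incl)) :=
      TensorProduct.map_injective_of_flat_flat _ _ C.incl_injective C.map_incl_injective
    have h1 : TensorProduct.map C.incl (TensorProduct.map C.incl C.incl) ∘ₗ
        (TensorProduct.assoc K C C C).toLinearMap =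
        (TensorProduct.assoc K H H H).toLinearMap ∘ₗ
          TensorProduct.map (TensorProduct.map C.incl C.incl) C.incl :=
      TensorProduct.ext_threefold fun _ _ _ => rfl
    refine LinearMap.ext fun c => hinj ?_
    have h2 : ∀ x : C ⊗[K] C, TensorProduct.map (TensorProduct.map C.incl C.incl) C.incl
        (LinearMap.rTensor C Coalgebra.comul x) =
        LinearMap.rTensor H Coalgebra.comul (TensorProduct.map C.incl C.incl x) := by
      intro x
      rw [← LinearMap.comp_apply, ← LinearMap.comp_apply, LinearMap.map_comp_rTensor,
        LinearMap.rTensor_comp_map, map_incl_comp_comul]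
    have h3 : ∀ x : C ⊗[K] C, TensorProduct.map C.incl (TensorProduct.map C.incl C.incl)
        (LinearMap.lTensor C Coalgebra.comul x) =
        LinearMap.lTensor H Coalgebra.comul (TensorProduct.map C.incl C.incl x) := by
      intro x
      rw [← LinearMap.comp_apply, ← LinearMap.comp_apply, LinearMap.map_comp_lTensor,
        LinearMap.lTensor_comp_map, map_incl_comp_comul]
    have h4 := LinearMap.congr_fun h1 (LinearMap.rTensor C Coalgebra.comul (Coalgebra.comul c))
    simp only [LinearMap.comp_apply, LinearEquiv.coe_coe] at h4 ⊢
    rw [h4, h2, h3, map_incl_comul]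
    exact Coalgebra.coassoc_apply _
  rTensor_counit_comp_comul := by
    refine LinearMap.ext fun c => Module.Flat.lTensor_preserves_injective_linearMap (M := K) C.incl
      C.incl_injective ?_
    have h : ∀ x : C ⊗[K] C, LinearMap.lTensor K C.incl (LinearMap.rTensor C Coalgebra.counit x) =
        LinearMap.rTensor H Coalgebra.counit (TensorProduct.map C.incl C.incl x) := by
      intro x
      rw [← LinearMap.comp_apply, ← LinearMap.comp_apply, LinearMap.lTensor_comp_rTensor,
        LinearMap.rTensor_comp_map]
      rfl
    rw [LinearMap.comp_apply, h, map_incl_comul, Coalgebra.rTensor_counit_comul]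
    rfl
  lTensor_counit_comp_comul := by
    refine LinearMap.ext fun c => Module.Flat.rTensor_preserves_injective_linearMap (M := K) C.incl
      C.incl_injective ?_
    have h : ∀ x : C ⊗[K] C, LinearMap.rTensor K C.incl (LinearMap.lTensor C Coalgebra.counit x) =
        LinearMap.lTensor H Coalgebra.counit (TensorProduct.map C.incl C.incl x) := by
      intro x
      rw [← LinearMap.comp_apply, ← LinearMap.comp_apply, LinearMap.rTensor_comp_lTensor,
        LinearMap.lTensor_comp_map]
      rfl
    rw [LinearMap.comp_apply, h, map_incl_comul, Coalgebra.lTensor_counit_comul]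
    rfl

end Subcoalgebra

/-! ### Coreflexive coalgebras -/

/-- The finite dual `A⁰` of a `K`-algebra `A`: the functionals whose kernel contains a two-sided
ideal of finite codimension. -/
def finiteDual (K A : Type*) [Field K] [Ring A] [Algebra K A] : Submodule K (Module.Dual K A) where
  carrier := {f | ∃ I : Ideal A, I.IsTwoSided ∧ FiniteDimensional K (A ⧸ I.restrictScalars K) ∧
    ∀ x ∈ I, f x = 0}
  zero_mem' := ⟨⊤, inferInstance, inferInstanceAs (FiniteDimensional K (A ⧸ (⊤ : Submodule K A))),
    fun _ _ => rfl⟩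
  add_mem' := by
    rintro f g ⟨I, hI, hI', hf⟩ ⟨J, hJ, hJ', hg⟩
    have h : (I.restrictScalars K ⊓ J.restrictScalars K).CoFG := Submodule.CoFG.inf hI' hJ'
    refine ⟨I ⊓ J, ⟨fun {x} y hx => ⟨hI.mul_mem_of_left y hx.1, hJ.mul_mem_of_left y hx.2⟩⟩, h,
      fun x hx => ?_⟩
    rw [LinearMap.add_apply, hf x hx.1, hg x hx.2, add_zero]
  smul_mem' := by
    rintro k f ⟨I, hI, hI', hf⟩
    exact ⟨I, hI, hI', fun x hx => by rw [LinearMap.smul_apply, hf x hx, smul_zero]⟩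

/-- The dual algebra `C*` of a coalgebra `C`: all linear forms on `C`, with the convolution product
`(f * g)(c) = ∑ f(c₁) g(c₂)` and the unit `ε`. -/
abbrev DualAlgebra (K C : Type*) [Field K] [AddCommGroup C] [Module K C] [Coalgebra K C] :=
  WithConv (C →ₗ[K] K)

section

variable (K C : Type*) [Field K] [AddCommGroup C] [Module K C] [Coalgebra K C]

/-- The natural map `C → (C*)*`, `c ↦ (f ↦ f(c))`. -/
def evalDual : C →ₗ[K] Module.Dual K (DualAlgebra K C) where
  toFun c := { toFun := fun f => f c, map_add' := fun _ _ => rfl, map_smul' := fun _ _ => rfl }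
  map_add' c d := by ext f; exact map_add f.ofConv c d
  map_smul' k c := by ext f; exact map_smul f.ofConv k c

theorem evalDual_mem (c : C) : evalDual K C c ∈ finiteDual K (DualAlgebra K C) := by
  classical
  let 𝓡 := Coalgebra.Repr.arbitrary K c
  let 𝓢 := fun i => Coalgebra.Repr.arbitrary K (𝓡.right i)
  have key : ∀ g f h : DualAlgebra K C, (g * (f * h)) c = ∑ i ∈ 𝓡.index,
      g (𝓡.left i) * ∑ j ∈ (𝓢 i).index, f ((𝓢 i).left j) * h ((𝓢 i).right j) := by
    intro g f h
    rw [𝓡.convMul_apply]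
    exact Finset.sum_congr rfl fun i _ => by rw [(𝓢 i).convMul_apply]
  let I : Ideal (DualAlgebra K C) :=
    { carrier := {f | ∀ g h : DualAlgebra K C, (g * (f * h)) c = 0}
      zero_mem' := fun g h => by rw [zero_mul, mul_zero]; rfl
      add_mem' := fun {f f'} hf hf' g h => by
        rw [add_mul, mul_add]
        exact (congrArg₂ (· + ·) (hf g h) (hf' g h)).trans (add_zero 0)
      smul_mem' := fun k f hf g h => by
        rw [smul_eq_mul, mul_assoc, ← mul_assoc]
        exact hf (g * k) h }
  refine ⟨I, ⟨fun {f} k hf g h => ?_⟩, ?_, fun f hf => ?_⟩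
  · rw [mul_assoc]
    exact hf g (k * h)
  · let S : Finset C := 𝓡.index.biUnion fun i => (𝓢 i).index.image (𝓢 i).left
    let T : DualAlgebra K C →ₗ[K] (S → K) := LinearMap.pi fun b => evalDual K C b
    refine Submodule.CoFG.of_le (S := LinearMap.ker T) ?_ (Submodule.CoFG.ker T)
    intro f hf g h
    rw [key]
    refine Finset.sum_eq_zero fun i hi => ?_
    rw [Finset.sum_eq_zero fun j hj => ?_, mul_zero]
    have hmem : (𝓢 i).left j ∈ S :=
      Finset.mem_biUnion.2 ⟨i, hi, Finset.mem_image_of_mem _ hj⟩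
    have : f ((𝓢 i).left j) = 0 := congrFun (LinearMap.mem_ker.1 hf) ⟨_, hmem⟩
    rw [this, zero_mul]
  · have := hf 1 1
    rwa [mul_one, one_mul] at this

/-- The natural map `C → (C*)⁰`. -/
def toFiniteDual : C →ₗ[K] finiteDual K (DualAlgebra K C) :=
  (evalDual K C).codRestrict _ (evalDual_mem K C)

/-- A coalgebra `C` is coreflexive if the natural embedding `C → (C*)⁰` is an isomorphism. -/
def IsCoreflexive : Prop := Function.Bijective (toFiniteDual K C)

end

end

open scoped TensorProduct

noncomputable section

open WithConv

/-! ### Functionals and finite-rank maps on tensor products -/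

section TensorMaps

variable {K C D : Type*} [Field K] [AddCommGroup C] [Module K C] [AddCommGroup D] [Module K D]

/-! Let `f` vanish on an ideal `I` of finite codimension in `(C ⊗ D)*`. The preimages of `I` in `C*`
and `D*` again have finite codimension, so by coreflexivity they contain annihilators of finite sets
`X` and `Y`. A sum of finitely many vertex functionals agrees with `ε` on `X`, and likewise on `Y`.
This gives `g` and `h` whose product `e = g ⊗ h` satisfies `1 - e ∈ I`, hence `f(a) = f(e a e)`.

The value of `e a e` depends only on the restriction of `a` to the range of `sandwich e`, which is
finite-dimensional since finitely many paths join the chosen vertices. So `f` factors through the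
dual of a finite-dimensional space and is an evaluation (`exists_evalDual_eq`). `HasFiniteSandwich`
isolates what is needed of path coalgebras. -/

/-- The functional `c ⊗ d ↦ g(c) h(d)`. -/
def tensorFunctional (g : C →ₗ[K] K) (h : D →ₗ[K] K) : C ⊗[K] D →ₗ[K] K :=
  (TensorProduct.lid K K).toLinearMap ∘ₗ TensorProduct.map g h

@[simp]
theorem tensorFunctional_tmul (g : C →ₗ[K] K) (h : D →ₗ[K] K) (c : C) (d : D) :
    tensorFunctional g h (c ⊗ₜ d) = g c * h d := rfl

theorem range_tensorProduct_map_fg {f : C →ₗ[K] C} {g : D →ₗ[K] D}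
    (hf : (LinearMap.range f).FG) (hg : (LinearMap.range g).FG) :
    (LinearMap.range (TensorProduct.map f g)).FG := by
  rw [TensorProduct.range_map]
  exact hf.map₂ _ hg

end TensorMaps

/-! ### Convolution as precomposition with contractions -/

section Contractions

variable {K C D : Type*} [Field K] [AddCommGroup C] [Module K C] [Coalgebra K C]
  [AddCommGroup D] [Module K D] [Coalgebra K D]

/-- The map `c ↦ ∑ g(c₁) c₂`, through which left convolution by `g` is computed. -/
def leftContract (g : C →ₗ[K] K) : C →ₗ[K] C :=
  (TensorProduct.lid K C).toLinearMap ∘ₗ LinearMap.rTensor C g ∘ₗ Coalgebra.comul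

/-- The map `c ↦ ∑ g(c₂) c₁`, through which right convolution by `g` is computed. -/
def rightContract (g : C →ₗ[K] K) : C →ₗ[K] C :=
  (TensorProduct.rid K C).toLinearMap ∘ₗ LinearMap.lTensor C g ∘ₗ Coalgebra.comul

/-- The map `c ↦ ∑ g(c₁) g(c₃) c₂`. -/
def sandwich (g : C →ₗ[K] K) : C →ₗ[K] C := rightContract g ∘ₗ leftContract g

theorem leftContract_repr (g : C →ₗ[K] K) {ι : Type*} {c : C} (r : Coalgebra.Repr K c ι) :
    leftContract g c = ∑ i ∈ r.index, g (r.left i) • r.right i := by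
  simp [leftContract, ← r.eq]

theorem rightContract_repr (g : C →ₗ[K] K) {ι : Type*} {c : C} (r : Coalgebra.Repr K c ι) :
    rightContract g c = ∑ i ∈ r.index, g (r.right i) • r.left i := by
  simp [rightContract, ← r.eq]

theorem convMul_eq_comp_leftContract (g a : DualAlgebra K C) :
    g * a = toConv (a.ofConv ∘ₗ leftContract g.ofConv) := by
  ext c
  have r := Coalgebra.Repr.arbitrary K c
  change (g * a) c = a.ofConv (leftContract g.ofConv c)
  rw [r.convMul_apply, leftContract_repr _ r]
  simp

theorem convMul_eq_comp_rightContract (a g : DualAlgebra K C) :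
    a * g = toConv (a.ofConv ∘ₗ rightContract g.ofConv) := by
  ext c
  have r := Coalgebra.Repr.arbitrary K c
  change (a * g) c = a.ofConv (rightContract g.ofConv c)
  rw [r.convMul_apply, rightContract_repr _ r]
  simp [mul_comm]

theorem convMul_convMul_eq_comp_sandwich (g a : DualAlgebra K C) :
    g * (a * g) = toConv (a.ofConv ∘ₗ sandwich g.ofConv) := by
  rw [convMul_eq_comp_leftContract, convMul_eq_comp_rightContract]
  rfl

theorem leftContract_tensorFunctional (g : C →ₗ[K] K) (h : D →ₗ[K] K) :
    leftContract (tensorFunctional g h) =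
      TensorProduct.map (leftContract g) (leftContract h) := by
  ext c d
  have r := Coalgebra.Repr.arbitrary K c
  have s := Coalgebra.Repr.arbitrary K d
  simp only [TensorProduct.AlgebraTensorModule.curry_apply, LinearMap.restrictScalars_self,
    TensorProduct.curry_apply, TensorProduct.map_tmul, leftContract_repr _ r,
    leftContract_repr _ s]
  simp [leftContract, TensorProduct.comul_tmul, ← r.eq, ← s.eq, TensorProduct.sum_tmul,
    TensorProduct.tmul_sum, Finset.smul_sum, TensorProduct.smul_tmul', smul_smul, mul_comm]

theorem rightContract_tensorFunctional (g : C →ₗ[K] K) (h : D →ₗ[K] K) :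
    rightContract (tensorFunctional g h) =
      TensorProduct.map (rightContract g) (rightContract h) := by
  ext c d
  have r := Coalgebra.Repr.arbitrary K c
  have s := Coalgebra.Repr.arbitrary K d
  simp only [TensorProduct.AlgebraTensorModule.curry_apply, LinearMap.restrictScalars_self,
    TensorProduct.curry_apply, TensorProduct.map_tmul, rightContract_repr _ r,
    rightContract_repr _ s]
  simp [rightContract, TensorProduct.comul_tmul, ← r.eq, ← s.eq, TensorProduct.sum_tmul,
    TensorProduct.tmul_sum, Finset.smul_sum, TensorProduct.smul_tmul', smul_smul, mul_comm]

theorem sandwich_tensorFunctional (g : C →ₗ[K] K) (h : D →ₗ[K] K) :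
    sandwich (tensorFunctional g h) = TensorProduct.map (sandwich g) (sandwich h) := by
  rw [sandwich, leftContract_tensorFunctional, rightContract_tensorFunctional,
    ← TensorProduct.map_comp]
  rfl

/-- Contractions are natural in comultiplicative maps. Used for the inclusion of a subcoalgebra, to
carry finite rank down from the path coalgebra. -/
theorem comp_sandwich_comp {f : C →ₗ[K] D}
    (hf : TensorProduct.map f f ∘ₗ Coalgebra.comul = Coalgebra.comul (R := K) ∘ₗ f)
    (g : D →ₗ[K] K) : f ∘ₗ sandwich (g ∘ₗ f) = sandwich g ∘ₗ f := by
  have hl : f ∘ₗ leftContract (g ∘ₗ f) = leftContract g ∘ₗ f := by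
    have h : f ∘ₗ (TensorProduct.lid K C).toLinearMap ∘ₗ LinearMap.rTensor C (g ∘ₗ f) =
        (TensorProduct.lid K D).toLinearMap ∘ₗ LinearMap.rTensor D g ∘ₗ TensorProduct.map f f := by
      ext; simp
    simp only [leftContract, LinearMap.comp_assoc, ← hf]
    simp only [← LinearMap.comp_assoc] at h ⊢
    rw [h]
  have hr : f ∘ₗ rightContract (g ∘ₗ f) = rightContract g ∘ₗ f := by
    have h : f ∘ₗ (TensorProduct.rid K C).toLinearMap ∘ₗ LinearMap.lTensor C (g ∘ₗ f) =
        (TensorProduct.rid K D).toLinearMap ∘ₗ LinearMap.lTensor D g ∘ₗ TensorProduct.map f f := by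
      ext; simp
    simp only [rightContract, LinearMap.comp_assoc, ← hf]
    simp only [← LinearMap.comp_assoc] at h ⊢
    rw [h]
  rw [sandwich, sandwich, ← LinearMap.comp_assoc, hr, LinearMap.comp_assoc, hl,
    LinearMap.comp_assoc]

end Contractions

/-! ### Ideals of finite codimension and evaluations -/

section Duality

variable {K C E : Type*} [Field K] [AddCommGroup C] [Module K C] [Coalgebra K C]
  [AddCommGroup E] [Module K E] [Coalgebra K E]

theorem toFiniteDual_injective : Function.Injective (toFiniteDual K C) := by
  refine (injective_iff_map_eq_zero _).2 fun c hc => ?_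
  refine (Module.forall_dual_apply_eq_zero_iff K c).1 fun φ => ?_
  exact LinearMap.congr_fun (congrArg Subtype.val hc) (toConv φ)

/-- A functional on `C*` that vanishes on an ideal `I` is an evaluation as soon as `I` contains
`1 - e` for some `e` such that `c ↦ ∑ e(c₁) e(c₃) c₂` has finite rank. -/
theorem exists_evalDual_eq (I : Ideal (DualAlgebra K C)) [I.IsTwoSided] (e : DualAlgebra K C)
    (he : 1 - e ∈ I) (hfin : (LinearMap.range (sandwich e.ofConv)).FG)
    (f : Module.Dual K (DualAlgebra K C)) (hf : ∀ x ∈ I, f x = 0) :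
    ∃ c, evalDual K C c = f := by
  have : Module.Finite K (LinearMap.range (sandwich e.ofConv)) := Module.Finite.iff_fg.2 hfin
  -- `Φ ψ` is `f` applied to `ψ` precomposed with the sandwich, so `f (e * (a * e))` is `Φ` of the
  -- restriction of `a` to the range.
  let Φ : Module.Dual K (Module.Dual K (LinearMap.range (sandwich e.ofConv))) :=
    f ∘ₗ (WithConv.linearEquiv K (C →ₗ[K] K)).symm.toLinearMap ∘ₗ
      LinearMap.lcomp K K (sandwich e.ofConv).rangeRestrict
  obtain ⟨x, hx⟩ := (Module.evalEquiv K (LinearMap.range (sandwich e.ofConv))).surjective Φ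
  refine ⟨x, LinearMap.ext fun a => ?_⟩
  have h1 : f a = f (e * (a * e)) := by
    rw [← sub_eq_zero, ← map_sub]
    refine hf _ ?_
    have : a - e * (a * e) = (1 - e) * a + e * a * (1 - e) := by
      simp only [sub_mul, mul_sub, one_mul, mul_one, mul_assoc]
      abel
    rw [this]
    exact I.add_mem (I.mul_mem_right _ he) (I.mul_mem_left _ he)
  rw [h1, convMul_convMul_eq_comp_sandwich]
  exact LinearMap.congr_fun hx (a.ofConv ∘ₗ Submodule.subtype _)

/-- In the dual of a coreflexive coalgebra, an ideal of finite codimension contains the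
annihilator of a finite set. -/
theorem IsCoreflexive.exists_finset (hC : IsCoreflexive K C) (I : Ideal (DualAlgebra K C))
    (hI : I.IsTwoSided) (hfin : (I.restrictScalars K).CoFG) :
    ∃ X : Finset C, ∀ a : DualAlgebra K C, (∀ x ∈ X, a x = 0) → a ∈ I := by
  classical
  have : FiniteDimensional K (DualAlgebra K C ⧸ I.restrictScalars K) := hfin
  -- Each functional in a basis of the dual of the quotient, lifted to `C*`, lies in the finite dual
  -- and is therefore evaluation at some `c i`. If `a` vanishes at every `c i`, its class in the
  -- quotient is killed by all functionals.
  let b := Module.finBasis K (Module.Dual K (DualAlgebra K C ⧸ I.restrictScalars K))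
  have hb : ∀ i, ∃ c, evalDual K C c = b i ∘ₗ (I.restrictScalars K).mkQ := fun i => by
    obtain ⟨c, hc⟩ := hC.2 ⟨b i ∘ₗ (I.restrictScalars K).mkQ, I, hI, hfin, fun x hx => by
      have : (I.restrictScalars K).mkQ x = 0 := (Submodule.Quotient.mk_eq_zero _).2 hx
      rw [LinearMap.comp_apply, this, map_zero]⟩
    exact ⟨c, congrArg Subtype.val hc⟩
  choose c hc using hb
  refine ⟨Finset.univ.image c, fun a ha => ?_⟩
  have h0 : (I.restrictScalars K).mkQ a = 0 := by
    refine (Module.forall_dual_apply_eq_zero_iff K _).1 fun φ => ?_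
    rw [← b.sum_repr φ, LinearMap.sum_apply]
    refine Finset.sum_eq_zero fun i _ => ?_
    rw [LinearMap.smul_apply, ← LinearMap.comp_apply, ← hc i]
    have : evalDual K C (c i) a = 0 := ha _ (Finset.mem_image_of_mem _ (Finset.mem_univ _))
    rw [this, smul_zero]
  exact (Submodule.Quotient.mk_eq_zero _).1 h0

/-- The algebra map `C* → E*` dual to a coalgebra map `E → C`. -/
def dualAlgebraMap (h : E →ₗc[K] C) : DualAlgebra K C →ₐ[K] DualAlgebra K E :=
  AlgHom.ofLinearMap
    ((WithConv.linearEquiv K (E →ₗ[K] K)).symm.toLinearMap ∘ₗ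
      LinearMap.lcomp K K h.toLinearMap ∘ₗ (WithConv.linearEquiv K (C →ₗ[K] K)).toLinearMap)
    (by ext x; exact CoalgHomClass.counit_comp_apply h x)
    (fun f g => WithConv.ext (LinearMap.convMul_comp_coalgHom_distrib f g h))

/-- The preimage of `I` is the kernel of a map into the finite-dimensional quotient by `I`, so it
too has finite codimension. -/
theorem IsCoreflexive.exists_finset_comap (hC : IsCoreflexive K C) (h : E →ₗc[K] C)
    (I : Ideal (DualAlgebra K E)) (hI : I.IsTwoSided) (hfin : (I.restrictScalars K).CoFG) :
    ∃ X : Finset C, ∀ a : DualAlgebra K C, (∀ x ∈ X, a x = 0) → dualAlgebraMap h a ∈ I := by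
  refine hC.exists_finset (I.comap (dualAlgebraMap h)) inferInstance ?_
  have : FiniteDimensional K (DualAlgebra K E ⧸ I.restrictScalars K) := hfin
  refine Submodule.CoFG.of_le (S := LinearMap.ker
    ((I.restrictScalars K).mkQ ∘ₗ (dualAlgebraMap h).toLinearMap)) ?_ (Submodule.CoFG.ker _)
  intro a ha
  exact (Submodule.Quotient.mk_eq_zero (I.restrictScalars K)).1 (LinearMap.mem_ker.1 ha)

end Duality

/-! ### Coreflexivity of a tensor product -/

section Projections

variable {K C D : Type*} [Field K] [AddCommGroup C] [Module K C] [Coalgebra K C]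
  [AddCommGroup D] [Module K D] [Coalgebra K D]

variable (K C D) in
/-- The coalgebra map `id ⊗ ε : C ⊗ D → C`. -/
def tensorFst : C ⊗[K] D →ₗc[K] C :=
  (Coalgebra.TensorProduct.rid K K C).toCoalgHom.comp
    (Coalgebra.TensorProduct.map (CoalgHom.id K C) (Coalgebra.counitCoalgHom K D))

variable (K C D) in
/-- The coalgebra map `ε ⊗ id : C ⊗ D → D`. -/
def tensorSnd : C ⊗[K] D →ₗc[K] D :=
  (Coalgebra.TensorProduct.lid K D).toCoalgHom.comp
    (Coalgebra.TensorProduct.map (Coalgebra.counitCoalgHom K C) (CoalgHom.id K D))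

/-- The two factors are `g ⊗ ε` and `ε ⊗ h`, and convolution on `C ⊗ D` is componentwise. -/
theorem dualAlgebraMap_mul_dualAlgebraMap (g : DualAlgebra K C) (h : DualAlgebra K D) :
    dualAlgebraMap (tensorFst K C D) g * dualAlgebraMap (tensorSnd K C D) h =
      toConv (tensorFunctional g.ofConv h.ofConv) := by
  have hg : dualAlgebraMap (tensorFst K C D) g =
      toConv (tensorFunctional g.ofConv Coalgebra.counit) := by
    ext c d
    exact (map_smul g.ofConv _ c).trans (mul_comm _ _)
  have hh : dualAlgebraMap (tensorSnd K C D) h =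
      toConv (tensorFunctional Coalgebra.counit h.ofConv) := by
    ext c d
    exact map_smul h.ofConv _ d
  rw [hg, hh, convMul_eq_comp_leftContract, leftContract_tensorFunctional]
  ext c d
  -- The unit laws `g * 1 = g` and `1 * h = h`, written through contractions, evaluate the two
  -- components.
  have h1 := congrArg (fun a : DualAlgebra K C => a c) (convMul_eq_comp_leftContract g 1)
  have h2 := congrArg (fun a : DualAlgebra K D => a d) (convMul_eq_comp_leftContract 1 h)
  rw [mul_one] at h1
  rw [one_mul] at h2
  exact (congrArg₂ (· * ·) h1 h2).symm

variable (K C) in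
/-- The annihilator in `C*` of each finite subset of `C` contains `1 - e` for some `e` such that
`c ↦ ∑ e(c₁) e(c₃) c₂` has finite rank. -/
def HasFiniteSandwich : Prop :=
  ∀ X : Finset C, ∃ e : DualAlgebra K C, (LinearMap.range (sandwich e.ofConv)).FG ∧
    ∀ x ∈ X, (1 - e) x = 0

theorem IsCoreflexive.tensorProduct (hC : IsCoreflexive K C) (hD : IsCoreflexive K D)
    (hC' : HasFiniteSandwich K C) (hD' : HasFiniteSandwich K D) :
    IsCoreflexive K (C ⊗[K] D) := by
  refine ⟨toFiniteDual_injective, ?_⟩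
  rintro ⟨f, I, hI, hfin, hf⟩
  obtain ⟨X, hX⟩ := hC.exists_finset_comap (tensorFst K C D) I hI hfin
  obtain ⟨Y, hY⟩ := hD.exists_finset_comap (tensorSnd K C D) I hI hfin
  obtain ⟨g, hg, hgX⟩ := hC' X
  obtain ⟨h, hh, hhY⟩ := hD' Y
  have h1 := hX _ hgX
  have h2 := hY _ hhY
  rw [map_sub, map_one] at h1 h2
  have h3 : 1 - toConv (tensorFunctional g.ofConv h.ofConv) ∈ I := by
    rw [← dualAlgebraMap_mul_dualAlgebraMap]
    have : ∀ x y : DualAlgebra K (C ⊗[K] D), 1 - x * y = 1 - x + x * (1 - y) :=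
      fun x y => by rw [mul_sub, mul_one]; abel
    rw [this]
    exact I.add_mem h1 (I.mul_mem_left _ h2)
  obtain ⟨c, hc⟩ := exists_evalDual_eq I _ h3
    (by rw [sandwich_tensorFunctional]; exact range_tensorProduct_map_fg hg hh) f hf
  exact ⟨c, Subtype.ext hc⟩

end Projections

/-! ### Finite sandwiches in path coalgebras -/

namespace PathCoalgebra

variable (K : Type*) [Field K] {V : Type*} [Quiver V]

open Classical in
/-- The sum of the functionals dual to the vertices in `F`. -/
def vertexSum (F : Finset V) : PathCoalgebra K V →ₗ[K] K :=
  (basis K V).constr K fun p => if p.2.2.length = 0 then if p.1 ∈ F then 1 else 0 else 0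

open Classical in
theorem vertexSum_ofPath (F : Finset V) {a b : V} (p : Quiver.Path a b) :
    vertexSum K F (ofPath K p) = if p.length = 0 then if a ∈ F then 1 else 0 else 0 :=
  (basis K V).constr_basis K _ _

-- Only the factorization of `p` with trivial first factor, the vertex `a`, survives.
open Classical in
theorem leftContract_vertexSum (F : Finset V) {a b : V} (p : Quiver.Path a b) :
    leftContract (vertexSum K F) (ofPath K p) = if a ∈ F then ofPath K p else 0 := by
  simp only [leftContract, LinearMap.comp_apply, comul_ofPath, map_list_sum, List.map_map,
    Function.comp_def, LinearMap.rTensor_tmul, vertexSum_ofPath, LinearEquiv.coe_coe,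
    TensorProduct.lid_tmul, ite_smul, zero_smul, one_smul]
  exact Quiver.Path.sum_splits_left p (fun c q r => if a ∈ F then ofPath K r else 0)

open Classical in
theorem rightContract_vertexSum (F : Finset V) {a b : V} (p : Quiver.Path a b) :
    rightContract (vertexSum K F) (ofPath K p) = if b ∈ F then ofPath K p else 0 := by
  simp only [rightContract, LinearMap.comp_apply, comul_ofPath, map_list_sum, List.map_map,
    Function.comp_def, LinearMap.lTensor_tmul, vertexSum_ofPath, LinearEquiv.coe_coe,
    TensorProduct.rid_tmul, ite_smul, zero_smul, one_smul]
  exact Quiver.Path.sum_splits_right p (fun c q r => if c ∈ F then ofPath K q else 0)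

/-- The sandwich keeps the paths that start and end in `F` and kills all others. Finiteness of the
path sets between vertices enters here. -/
theorem range_sandwich_vertexSum_fg (hV : ∀ a b : V, Finite (Quiver.Path a b)) (F : Finset V) :
    (LinearMap.range (sandwich (vertexSum K F))).FG := by
  classical
  let S : Set (PathCoalgebra K V) :=
    Set.range fun p : Σ a : F, Σ b : F, Quiver.Path (a : V) (b : V) => ofPath K p.2.2
  have hS : S.Finite := Set.finite_range _
  refine (Submodule.fg_span hS).of_le ?_
  rw [LinearMap.range_eq_map, ← (basis K V).span_eq, Submodule.map_span, Submodule.span_le]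
  rintro _ ⟨_, ⟨⟨a, b, p⟩, rfl⟩, rfl⟩
  change rightContract _ (leftContract _ (ofPath K p)) ∈ _
  rw [leftContract_vertexSum]
  split_ifs with ha
  · rw [rightContract_vertexSum]
    split_ifs with hb
    · exact Submodule.subset_span ⟨⟨⟨a, ha⟩, ⟨b, hb⟩, p⟩, rfl⟩
    · exact zero_mem _
  · rw [map_zero]
    exact zero_mem _

theorem exists_vertexSum_eq_counit (X : Finset (PathCoalgebra K V)) :
    ∃ F : Finset V, ∀ x ∈ X, Coalgebra.counit (R := K) x = vertexSum K F x := by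
  classical
  -- Sources of all paths in the supports suffice: on a path of positive length both functionals
  -- vanish, and a vertex is its own source.
  refine ⟨X.biUnion fun x => ((basis K V).repr x).support.image Sigma.fst, fun x hx => ?_⟩
  refine LinearMap.eqOn_span (s := basis K V '' ((basis K V).repr x).support) ?_
    ((basis K V).mem_span_repr_support x)
  rintro _ ⟨⟨a, b, p⟩, hp, rfl⟩
  refine (counit_ofPath K p).trans (Eq.trans ?_ (vertexSum_ofPath K _ p).symm)
  rw [if_pos (Finset.mem_biUnion.2 ⟨x, hx, Finset.mem_image.2 ⟨_, hp, rfl⟩⟩)]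

theorem hasFiniteSandwich_subcoalgebra {K : Type*} [Field K] {V : Type*} [Quiver V]
    (hV : ∀ a b : V, Finite (Quiver.Path a b)) (C : Subcoalgebra K (PathCoalgebra K V)) :
    HasFiniteSandwich K C := by
  classical
  intro X
  obtain ⟨F, hF⟩ := exists_vertexSum_eq_counit K (X.image C.incl)
  refine ⟨toConv (vertexSum K F ∘ₗ C.incl), ?_, fun x hx => ?_⟩
  · refine Submodule.fg_of_fg_map_injective C.incl C.incl_injective ?_
    rw [← LinearMap.range_comp]
    refine (range_sandwich_vertexSum_fg K hV F).of_le ?_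
    change LinearMap.range (C.incl ∘ₗ sandwich (vertexSum K F ∘ₗ C.incl)) ≤ _
    rw [comp_sandwich_comp C.map_incl_comp_comul]
    exact LinearMap.range_comp_le_range _ _
  · exact sub_eq_zero.2 (hF _ (Finset.mem_image_of_mem _ hx))

end PathCoalgebra

end

theorem proposition5p11 {K : Type*} [Field K]
    {V : Type*} [Quiver V] (hV : ∀ a b : V, Finite (Quiver.Path a b))
    {V' : Type*} [Quiver V'] (hV' : ∀ a b : V', Finite (Quiver.Path a b))
    (C : Subcoalgebra K (PathCoalgebra K V)) (D : Subcoalgebra K (PathCoalgebra K V'))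
    (hC : IsCoreflexive K C) (hD : IsCoreflexive K D) :
    IsCoreflexive K (C ⊗[K] D) :=
  hC.tensorProduct hD (PathCoalgebra.hasFiniteSandwich_subcoalgebra hV C)
    (PathCoalgebra.hasFiniteSandwich_subcoalgebra hV' D)
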